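/- For $\beta\in(0,1)$ let $T_\beta:[0,1]\to[0,1]$ be the modified Pomeau–Manneville map $$T_\beta(x)=\begin{cases}x+\dfrac{3^{\beta}}{2^{1+\beta}}\,x^{1+\beta}, & 0\le x\le 2/3,\\[4pt] 3x-2, & 2/3<x\le 1,\end{cases}$$ and let $P_\beta$ be its Perron–Frobenius (transfer) operator with respect to Lebesgue measure $m$: for $x\in(0,1]$, $P_\beta f(x)=\sum_{y\in(0,1],\,T_\beta(y)=x} f(y)/T_\beta'(y)$, with the left derivative at $y=2/3$. Write $\|f\|_1=\int_0^1|f|\,dm$. For $0<\alpha<1$ and $a\in\mathbb R$ let $\mathcal C_2(\alpha,a)$ be the set of continuous functions $f:(0,1]\to[0,\infty)$, integrable with respect to $m$, such that $f$ is nonincreasing, $x\mapsto x^{\alpha+1}f(x)$ is nondecreasing, and $f(x)\le a\,x^{-\alpha}\int_0^1 f\,dm$ for all $x\in(0,1]$. Let $0<\alpha<1$. (i) For every $a$ there is a constant $C$, depending only on $\alpha$ and $a$, such that for all $n>1$, all $\beta_1,\dots,\beta_n\in(0,\alpha]$ and all $\varphi,\psi\in\mathcal C_2(\alpha,a)$ with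 $\int_0^1\varphi\,dm=\int_0^1\psi\,dm$, the functions $P_{\beta_n}\circ\cdots\circ P_{\beta_1}\varphi$ and $P_{\beta_n}\circ\cdots\circ P_{\beta_1}\psi$ are integrable and $$\int_0^1\bigl|P_{\beta_n}\circ\cdots\circ P_{\beta_1}(\varphi)-P_{\beta_n}\circ\cdots\circ P_{\beta_1}(\psi)\bigr|\,dm\le C\,(\|\varphi\|_1+\|\psi\|_1)\,n^{1-\frac1\alpha}(\log n)^{\frac1\alpha}.$$ (ii) There are an affine function $\mathcal F:\mathbb R\to\mathbb R$, which does not depend on anything (not even on $\alpha$), and a constant $C_\alpha$, depending only on $\alpha$, such that for all $n>1$, all $\beta_1,\dots,\beta_n\in(0,\alpha]$ and all real $C^1$ functions $\varphi,\psi$ on the circle $S^1=\mathbb R/\mathbb Z$ (regarded as functions on the unit interval) with $\int_0^1\varphi\,dm=\int_0^1\psi\,dm$, the functions $P_{\beta_n}\circ\cdots\circ P_{\beta_1}\varphi$ and $P_{\beta_n}\circ\cdots\circ P_{\beta_1}\psi$ are integrable and $$\int_0^1\bigl|P_{\beta_n}\circ\cdots\circ P_{\beta_1}(\varphi)-P_{\beta_n}\circ\cdots\circ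 P_{\beta_1}(\psi)\bigr|\,dm\le C_\alpha\,\mathcal F\bigl(\|\varphi\|_{C^1}+\|\psi\|_{C^1}\bigr)\,n^{1-\frac1\alpha}(\log n)^{\frac1\alpha},$$ where $\|f\|_{C^1}=\sup|f|+\sup|f'|$. -/

import Mathlib

open MeasureTheory Set

noncomputable section

namespace PomeauManneville

/-- The modified Pomeau–Manneville map with exponent `β` (meant on `[0, 1]`):
`x + (3 ^ β / 2 ^ (1 + β)) x ^ (1 + β)` for `x ≤ 2/3` and `3 x - 2` for `x > 2/3`.
The points `0` and `1` are identified, so the value at `2/3` is immaterial (`1` or `0`). -/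
def map (β x : ℝ) : ℝ :=
  if x ≤ 2 / 3 then x + (3 : ℝ) ^ β / (2 : ℝ) ^ (1 + β) * x ^ (1 + β) else 3 * x - 2

/-- The derivative of `map β` on `(0, 1]`; at the corner `2/3` it is the left derivative,
in agreement with the choice of branch at that point. -/
def mapDeriv (β x : ℝ) : ℝ :=
  if x ≤ 2 / 3 then 1 + (1 + β) * ((3 : ℝ) ^ β / (2 : ℝ) ^ (1 + β)) * x ^ β else 3

/-- The Perron–Frobenius transfer operator of `map β` with respect to Lebesgue measure
on the unit interval `(0, 1]`: `(P f)(x) = ∑ f(y) / T'(y)` over the preimages `y ∈ (0, 1]` of `x`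
(every `x ∈ (0, 1]` has exactly two of them when `β > 0`). -/
def transfer (β : ℝ) (f : ℝ → ℝ) (x : ℝ) : ℝ :=
  ∑ᶠ y ∈ {y : ℝ | y ∈ Ioc (0 : ℝ) 1 ∧ map β y = x}, f y / mapDeriv β y

/-- The concatenation `P_{β n} ∘ ⋯ ∘ P_{β 1}` applied to `f`. -/
def transferSeq (β : ℕ → ℝ) : ℕ → (ℝ → ℝ) → ℝ → ℝ
  | 0, f => f
  | n + 1, f => transfer (β (n + 1)) (transferSeq β n f)

/-- The cone of nonnegative continuous functions `f` on `(0, 1]` such that `f` is decreasing and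
`x ^ (α + 1) * f x` is increasing (both in the wide sense). -/
def coneOne (α : ℝ) : Set (ℝ → ℝ) :=
  {f | ContinuousOn f (Ioc 0 1) ∧ (∀ x ∈ Ioc (0 : ℝ) 1, 0 ≤ f x) ∧ AntitoneOn f (Ioc 0 1) ∧
    MonotoneOn (fun x => x ^ (α + 1) * f x) (Ioc 0 1)}

/-- The cone of integrable `f` in `coneOne α` with `f x ≤ a * x ^ (-α) * ∫ f` on `(0, 1]`. -/
def coneTwo (α a : ℝ) : Set (ℝ → ℝ) :=
  {f | f ∈ coneOne α ∧ IntegrableOn f (Ioc 0 1) ∧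
    ∀ x ∈ Ioc (0 : ℝ) 1, f x ≤ a * x ^ (-α) * ∫ t in Ioc (0 : ℝ) 1, f t}

/-- The `L¹` norm on the unit interval with Lebesgue measure. -/
def normL1 (f : ℝ → ℝ) : ℝ := ∫ x in Ioc (0 : ℝ) 1, |f x|

/-- Real functions of class `C¹` on the circle `ℝ / ℤ`, written as `1`-periodic functions. -/
def IsC1Circle (f : ℝ → ℝ) : Prop := ContDiff ℝ 1 f ∧ Function.Periodic f 1

/-- The norm `sup |f| + sup |f'|` of a `C¹` function on the circle. -/
def normC1 (f : ℝ → ℝ) : ℝ := (⨆ x : ℝ, |f x|) + ⨆ x : ℝ, |deriv f x|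

/-- The rate `n ^ (1 - 1/α) * (log n) ^ (1/α)`. -/
def rate (α : ℝ) (n : ℕ) : ℝ := (n : ℝ) ^ (1 - 1 / α) * Real.log n ^ (1 / α)

end PomeauManneville

end

/-!
The proof is a coupling argument that subtracts a small constant from both densities at every
iteration and needs neither distortion estimates nor the positivity of an averaged kernel.

On the left branch the map is `y ↦ y * (1 + u)` with `u = (3 y / 2) ^ β / 2` and derivative
`1 + (1 + β) * u`. The transfer operator preserves the cone of densities `h` that decrease while
`x ^ (α + 1) * h x` increases, and the right branch, which stays away from the neutral fixed point,
leaves room in that cone: `P h - c` still belongs to it when `c` is a small multiple of `h 1`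
(`right_term_sub_mono`, `shapeCone_transfer_sub`). The cost of subtracting `c` is in the bound
`h x ≤ A * m * x ^ (-α)` relative to the mass `m`, which has become smaller. The left branch improves
this bound by a fixed amount (`rpow_neg_div_deriv_le`), so that for `x ≥ ε` it survives a relative loss
of mass `κ = θ * ε ^ α`. Below the scale `ε` the density is cut at height about `A * m * ε ^ (-α)`; in
one iteration the excess over this height is only `O(m)`, on an interval of length `ε`, and spreading
it uniformly restores the mass (`exists_tame_approx`). Hence a tame density of mass `m` is mapped to
the constant `κ * m` plus a tame density of mass `(1 - κ) * m`, up to an error `O(m * ε)` in `L¹`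
(`exists_tame_transfer`).

For two densities of equal mass the constants cancel. After `n` iterations the masses left are
`(1 - κ) ^ n * m`, and the errors sum to `O(m * ε / κ) = O(m * ε ^ (1 - α))`, which is also the cost
of the initial truncation (`exists_tame_coupling`, `loss_of_memory_bound`). The choice
`ε ^ α = K * log n / n` gives the rate (`exists_rate_bound`).

For `C¹` functions the same affine function is subtracted from both, which moves them into the cone
and does not change their difference (`mem_coneTwo_of_C1`). The affine function of the norms can be
taken to be the identity.
-/

noncomputable section

namespace PomeauManneville

/-! ### The two branches of the map -/

/-- The relative displacement `u = (3 y / 2) ^ β / 2` of the left branch: there the map is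
`y ↦ y * (1 + u)` and its derivative is `1 + (1 + β) * u`. -/
def displacement (β y : ℝ) : ℝ := 1 / 2 * (3 / 2 * y) ^ β

lemma coeff_mul_rpow {β y : ℝ} (hy : 0 ≤ y) :
    (3 : ℝ) ^ β / (2 : ℝ) ^ (1 + β) * y ^ β = displacement β y := by
  unfold displacement
  rw [Real.mul_rpow (by norm_num) hy, Real.div_rpow (by norm_num) (by norm_num),
    Real.rpow_add (by norm_num), Real.rpow_one]
  field_simp

lemma map_of_le {β y : ℝ} (hy : 0 < y) (hy' : y ≤ 2 / 3) :
    map β y = y * (1 + displacement β y) := by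
  rw [map, if_pos hy', ← coeff_mul_rpow hy.le, Real.rpow_add hy, Real.rpow_one]
  ring

lemma mapDeriv_of_le {β y : ℝ} (hy : 0 < y) (hy' : y ≤ 2 / 3) :
    mapDeriv β y = 1 + (1 + β) * displacement β y := by
  rw [mapDeriv, if_pos hy', ← coeff_mul_rpow hy.le]
  ring

lemma displacement_nonneg {β y : ℝ} (hy : 0 ≤ y) : 0 ≤ displacement β y := by
  unfold displacement; positivity

lemma displacement_le_half {β y : ℝ} (hβ : 0 ≤ β) (hy : 0 ≤ y) (hy' : y ≤ 2 / 3) :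
    displacement β y ≤ 1 / 2 := by
  have : (3 / 2 * y) ^ β ≤ 1 := Real.rpow_le_one (by positivity) (by linarith) hβ
  unfold displacement; linarith

lemma displacement_mono {β y z : ℝ} (hβ : 0 ≤ β) (hy : 0 ≤ y) (hyz : y ≤ z) :
    displacement β y ≤ displacement β z := by
  unfold displacement; gcongr

lemma strictMonoOn_map {β : ℝ} (hβ : 0 < β) : StrictMonoOn (map β) (Ioc 0 (2 / 3)) := by
  intro y hy z hz hyz
  rw [map_of_le hy.1 hy.2, map_of_le hz.1 hz.2]
  have h1 := displacement_mono hβ.le hy.1.le hyz.le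
  have h2 := displacement_nonneg (β := β) hy.1.le
  exact mul_lt_mul hyz (by linarith) (by linarith) hz.1.le

lemma image_map_left {β : ℝ} (hβ : 0 < β) : map β '' Ioc 0 (2 / 3) = Ioc 0 1 := by
  have h0 : ContinuousOn (fun y => y * (1 + displacement β y)) (Icc 0 (2 / 3)) := by
    have : Continuous (fun y => y * (1 + displacement β y)) := by
      unfold displacement
      have := Real.continuous_rpow_const (q := β) hβ.le
      fun_prop
    exact this.continuousOn
  have h23 : displacement β (2 / 3) = 1 / 2 := by
    unfold displacement
    norm_num
  ext x
  constructor
  · rintro ⟨y, hy, rfl⟩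
    have h1 := displacement_nonneg (β := β) hy.1.le
    have h2 := displacement_le_half hβ.le hy.1.le hy.2
    rw [map_of_le hy.1 hy.2]
    constructor
    · have := hy.1
      positivity
    · nlinarith [hy.1, hy.2]
  · intro hx
    have := intermediate_value_Ioc (by norm_num : (0 : ℝ) ≤ 2 / 3) h0
    obtain ⟨y, hy, hyx⟩ := this (a := x) (by
      simp only [h23, zero_mul]
      norm_num
      exact hx)
    exact ⟨y, hy, by rw [map_of_le hy.1 hy.2]; exact hyx⟩

/-! ### The inverse branches -/

/-- The inverse of the left branch `(0, 2/3] → (0, 1]` of `map β`; only its values on `(0, 1]`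
are meaningful. -/
def leftInv (β x : ℝ) : ℝ := Function.invFunOn (map β) (Ioc 0 (2 / 3)) x

lemma leftInv_mem {β x : ℝ} (hβ : 0 < β) (hx : x ∈ Ioc (0 : ℝ) 1) :
    leftInv β x ∈ Ioc (0 : ℝ) (2 / 3) := by
  rw [← image_map_left hβ] at hx
  exact Function.invFunOn_mem hx

lemma map_leftInv {β x : ℝ} (hβ : 0 < β) (hx : x ∈ Ioc (0 : ℝ) 1) :
    map β (leftInv β x) = x := by
  rw [← image_map_left hβ] at hx
  exact Function.invFunOn_eq hx

lemma leftInv_map {β y : ℝ} (hβ : 0 < β) (hy : y ∈ Ioc (0 : ℝ) (2 / 3)) :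
    leftInv β (map β y) = y :=
  (strictMonoOn_map hβ).injOn.leftInvOn_invFunOn hy

lemma leftInv_mono {β x x' : ℝ} (hβ : 0 < β) (hx : x ∈ Ioc (0 : ℝ) 1) (hx' : x' ∈ Ioc (0 : ℝ) 1)
    (h : x ≤ x') : leftInv β x ≤ leftInv β x' := by
  rw [← (strictMonoOn_map hβ).le_iff_le (leftInv_mem hβ hx) (leftInv_mem hβ hx'),
    map_leftInv hβ hx, map_leftInv hβ hx']
  exact h

lemma leftInv_eq {β x : ℝ} (hβ : 0 < β) (hx : x ∈ Ioc (0 : ℝ) 1) :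
    x = leftInv β x * (1 + displacement β (leftInv β x)) := by
  have h := leftInv_mem hβ hx
  rw [← map_of_le h.1 h.2, map_leftInv hβ hx]

lemma map_right {β y : ℝ} (hy : 2 / 3 < y) : map β y = 3 * y - 2 := by
  rw [map, if_neg hy.not_ge]

lemma mapDeriv_right {β y : ℝ} (hy : 2 / 3 < y) : mapDeriv β y = 3 := by
  rw [mapDeriv, if_neg hy.not_ge]

lemma transfer_eq {β x : ℝ} (hβ : 0 < β) (hx : x ∈ Ioc (0 : ℝ) 1) (f : ℝ → ℝ) :
    transfer β f x = f (leftInv β x) / mapDeriv β (leftInv β x) + f ((x + 2) / 3) / 3 := by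
  have hm := leftInv_mem hβ hx
  have hr : 2 / 3 < (x + 2) / 3 := by linarith [hx.1]
  have hset : {y : ℝ | y ∈ Ioc (0 : ℝ) 1 ∧ map β y = x} = {leftInv β x, (x + 2) / 3} := by
    ext y
    simp only [mem_ofPred_eq, mem_insert_iff, mem_singleton_iff]
    constructor
    · rintro ⟨hy, rfl⟩
      rcases le_or_gt y (2 / 3) with h | h
      · exact Or.inl (leftInv_map hβ ⟨hy.1, h⟩).symm
      · right
        rw [map_right h]; ring
    · rintro (rfl | rfl)
      · exact ⟨⟨hm.1, hm.2.trans (by norm_num)⟩, map_leftInv hβ hx⟩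
      · refine ⟨⟨by linarith, by linarith [hx.2]⟩, ?_⟩
        rw [map_right hr]; ring
  rw [transfer, hset, finsum_mem_pair (by linarith [hm.2] : leftInv β x < (x + 2) / 3).ne]
  rw [mapDeriv_right hr]

/-! ### Action of the transfer operator on integrable functions -/

lemma mapDeriv_pos {β y : ℝ} (hβ : 0 < β) (hy : 0 < y) : 0 < mapDeriv β y := by
  unfold mapDeriv
  split_ifs
  · positivity
  · norm_num

lemma hasDerivWithinAt_map_left {β y : ℝ} (hy : y ∈ Ioc (0 : ℝ) (2 / 3)) :
    HasDerivWithinAt (map β) (mapDeriv β y) (Ioc 0 (2 / 3)) y := by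
  have h1 : HasDerivAt (fun x : ℝ => x + (3 : ℝ) ^ β / (2 : ℝ) ^ (1 + β) * x ^ (1 + β))
      (mapDeriv β y) y := by
    rw [mapDeriv, if_pos hy.2]
    refine ((hasDerivAt_id y).add ((Real.hasDerivAt_rpow_const (p := 1 + β)
      (Or.inl hy.1.ne')).const_mul ((3 : ℝ) ^ β / (2 : ℝ) ^ (1 + β)))).congr_deriv ?_
    rw [show 1 + β - 1 = β by ring]
    ring
  refine h1.hasDerivWithinAt.congr (fun z hz => ?_) ?_
  · rw [map, if_pos hz.2]
  · rw [map, if_pos hy.2]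

lemma image_right : (fun y : ℝ => 3 * y - 2) '' Ioc (2 / 3) 1 = Ioc 0 1 := by
  ext x
  constructor
  · rintro ⟨y, hy, rfl⟩
    exact ⟨by linarith [hy.1], by linarith [hy.2]⟩
  · intro hx
    exact ⟨(x + 2) / 3, ⟨by linarith [hx.1], by linarith [hx.2]⟩, by ring⟩

lemma hasDerivWithinAt_right (y : ℝ) :
    HasDerivWithinAt (fun y : ℝ => 3 * y - 2) 3 (Ioc (2 / 3) 1) y := by
  simpa using (((hasDerivAt_id y).const_mul 3).sub_const 2).hasDerivWithinAt

lemma injOn_right : InjOn (fun y : ℝ => 3 * y - 2) (Ioc (2 / 3) 1) := by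
  intro y _ z _ h
  simp only at h
  linarith

lemma left_smul_eq {β : ℝ} (hβ : 0 < β) (f : ℝ → ℝ) {y : ℝ} (hy : y ∈ Ioc (0 : ℝ) (2 / 3)) :
    |mapDeriv β y| • (f (leftInv β (map β y)) / mapDeriv β (leftInv β (map β y))) = f y := by
  have := mapDeriv_pos hβ hy.1
  rw [leftInv_map hβ hy, abs_of_pos this, smul_eq_mul]
  field_simp

lemma right_smul_eq (f : ℝ → ℝ) (y : ℝ) :
    |(3 : ℝ)| • (f ((3 * y - 2 + 2) / 3) / 3) = f y := by
  rw [abs_of_pos (by norm_num : (0 : ℝ) < 3), smul_eq_mul,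
    show (3 * y - 2 + 2) / 3 = y by ring]
  ring

lemma integrableOn_left {β : ℝ} (hβ : 0 < β) {f : ℝ → ℝ} (hf : IntegrableOn f (Ioc 0 1)) :
    IntegrableOn (fun x => f (leftInv β x) / mapDeriv β (leftInv β x)) (Ioc 0 1) := by
  rw [← image_map_left hβ, integrableOn_image_iff_integrableOn_abs_deriv_smul measurableSet_Ioc
    (fun y hy => hasDerivWithinAt_map_left hy) (strictMonoOn_map hβ).injOn]
  refine (hf.mono_set (Ioc_subset_Ioc_right (by norm_num : (2 / 3 : ℝ) ≤ 1))).congr_fun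
    (fun y hy => (left_smul_eq hβ f hy).symm) measurableSet_Ioc

lemma integrableOn_right {f : ℝ → ℝ} (hf : IntegrableOn f (Ioc 0 1)) :
    IntegrableOn (fun x => f ((x + 2) / 3) / 3) (Ioc 0 1) := by
  rw [← image_right, integrableOn_image_iff_integrableOn_abs_deriv_smul measurableSet_Ioc
    (fun y _ => hasDerivWithinAt_right y) injOn_right]
  refine (hf.mono_set (Ioc_subset_Ioc_left (by norm_num : (0 : ℝ) ≤ 2 / 3))).congr_fun
    (fun y _ => (right_smul_eq f y).symm) measurableSet_Ioc

lemma integrableOn_transfer {β : ℝ} (hβ : 0 < β) {f : ℝ → ℝ} (hf : IntegrableOn f (Ioc 0 1)) :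
    IntegrableOn (transfer β f) (Ioc 0 1) :=
  ((integrableOn_left hβ hf).add (integrableOn_right hf)).congr_fun
    (fun _ hx => (transfer_eq hβ hx f).symm) measurableSet_Ioc

lemma integral_transfer {β : ℝ} (hβ : 0 < β) {f : ℝ → ℝ} (hf : IntegrableOn f (Ioc 0 1)) :
    ∫ x in Ioc (0 : ℝ) 1, transfer β f x = ∫ x in Ioc (0 : ℝ) 1, f x := by
  have hl : ∫ x in Ioc (0 : ℝ) 1, f (leftInv β x) / mapDeriv β (leftInv β x)
      = ∫ y in Ioc (0 : ℝ) (2 / 3), f y := by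
    rw [← image_map_left hβ, integral_image_eq_integral_abs_deriv_smul measurableSet_Ioc
      (fun y hy => hasDerivWithinAt_map_left hy) (strictMonoOn_map hβ).injOn]
    exact setIntegral_congr_fun measurableSet_Ioc fun y hy => left_smul_eq hβ f hy
  have hr : ∫ x in Ioc (0 : ℝ) 1, f ((x + 2) / 3) / 3 = ∫ y in Ioc (2 / 3 : ℝ) 1, f y := by
    rw [← image_right, integral_image_eq_integral_abs_deriv_smul measurableSet_Ioc
      (fun y _ => hasDerivWithinAt_right y) injOn_right]
    exact setIntegral_congr_fun measurableSet_Ioc fun y _ => right_smul_eq f y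
  rw [setIntegral_congr_fun measurableSet_Ioc fun x hx => transfer_eq hβ hx f,
    integral_add (integrableOn_left hβ hf) (integrableOn_right hf), hl, hr,
    ← setIntegral_union (Ioc_disjoint_Ioc_of_le le_rfl) measurableSet_Ioc
      (hf.mono_set (Ioc_subset_Ioc_right (by norm_num)))
      (hf.mono_set (Ioc_subset_Ioc_left (by norm_num))),
    Ioc_union_Ioc_eq_Ioc (by norm_num) (by norm_num)]

lemma transfer_sub {β x : ℝ} (hβ : 0 < β) (hx : x ∈ Ioc (0 : ℝ) 1) (f g : ℝ → ℝ) :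
    transfer β (fun y => f y - g y) x = transfer β f x - transfer β g x := by
  simp only [transfer_eq hβ hx]
  ring

lemma abs_transfer_le {β x : ℝ} (hβ : 0 < β) (hx : x ∈ Ioc (0 : ℝ) 1) (f : ℝ → ℝ) :
    |transfer β f x| ≤ transfer β (fun y => |f y|) x := by
  simp only [transfer_eq hβ hx]
  refine (abs_add_le _ _).trans (le_of_eq ?_)
  rw [abs_div, abs_div, abs_of_pos (mapDeriv_pos hβ (leftInv_mem hβ hx).1),
    abs_of_pos (by norm_num : (0 : ℝ) < 3)]

lemma integral_abs_transfer_le {β : ℝ} (hβ : 0 < β) {f : ℝ → ℝ} (hf : IntegrableOn f (Ioc 0 1)) :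
    ∫ x in Ioc (0 : ℝ) 1, |transfer β f x| ≤ ∫ x in Ioc (0 : ℝ) 1, |f x| := by
  rw [← integral_transfer hβ hf.abs]
  exact setIntegral_mono_on (integrableOn_transfer hβ hf).abs (integrableOn_transfer hβ hf.abs)
    measurableSet_Ioc fun x hx => abs_transfer_le hβ hx f

/-! ### The cone of shapes and its invariance -/

/-- The conditions on the shape of a density in `coneOne α`, without continuity: measurability is
never needed beyond integrability, which is carried separately. -/
structure ShapeCone (α : ℝ) (h : ℝ → ℝ) : Prop where
  nonneg : ∀ x ∈ Ioc (0 : ℝ) 1, 0 ≤ h x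
  anti : AntitoneOn h (Ioc 0 1)
  mono : MonotoneOn (fun x => x ^ (α + 1) * h x) (Ioc 0 1)

/-- A density of mass `m` with the shape of the cone and `h x ≤ A * m * (max x ε) ^ (-α)`, the
bound being split into the two cases of the maximum. In contrast with `coneTwo`, such a density is
bounded: the cap at scale `ε` is what leaves room to subtract a constant at each iteration. -/
structure TameDensity (α A ε m : ℝ) (h : ℝ → ℝ) : Prop extends ShapeCone α h where
  integrable : IntegrableOn h (Ioc 0 1)
  integral_eq : ∫ x in Ioc (0 : ℝ) 1, h x = m
  le_rpow : ∀ x ∈ Ioc (0 : ℝ) 1, h x ≤ A * m * x ^ (-α)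
  le_cap : ∀ x ∈ Ioc (0 : ℝ) 1, h x ≤ A * m * ε ^ (-α)

/-- Monotonicity of the factor by which the left branch multiplies `y ^ (α + 1) * h y`; by
Bernoulli's inequality, and this is where `β ≤ α` enters the invariance of the cone. -/
lemma left_weight_mono {α β u v : ℝ} (hβ : 0 < β) (hβα : β ≤ α) (hu : 0 ≤ u) (huv : u ≤ v) :
    (1 + u) ^ (α + 1) / (1 + (1 + β) * u) ≤ (1 + v) ^ (α + 1) / (1 + (1 + β) * v) := by
  have hα : 0 < α := hβ.trans_le hβα
  have hv : 0 ≤ v := hu.trans huv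
  set t := (v - u) / (1 + u) with ht
  have ht0 : 0 ≤ t := div_nonneg (by linarith) (by linarith)
  have hvu : 1 + v = (1 + u) * (1 + t) := by rw [ht]; field_simp; ring
  have hb : 1 + (α + 1) * t ≤ (1 + t) ^ (α + 1) :=
    one_add_mul_self_le_rpow_one_add (by linarith) (by linarith)
  rw [div_le_div_iff₀ (by positivity) (by positivity), hvu,
    Real.mul_rpow (by positivity) (by positivity), mul_assoc]
  refine mul_le_mul_of_nonneg_left ?_ (by positivity)
  have hvt : v = u + (1 + u) * t := by linarith
  have h1 : 1 + (1 + β) * v ≤ (1 + (α + 1) * t) * (1 + (1 + β) * u) := by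
    rw [hvt]
    nlinarith [mul_nonneg ht0 hu, mul_nonneg (mul_nonneg ht0 hu) hβ.le,
      mul_nonneg (mul_nonneg ht0 hu) (sub_nonneg.2 hβα), mul_nonneg ht0 (sub_nonneg.2 hβα),
      mul_nonneg (mul_nonneg (mul_nonneg ht0 hu) hβ.le) hα.le]
  exact h1.trans (mul_le_mul_of_nonneg_right hb (by positivity))

lemma left_term_mono {α β : ℝ} {h : ℝ → ℝ} (hβ : 0 < β) (hβα : β ≤ α) (hh : ShapeCone α h) :
    MonotoneOn (fun x => x ^ (α + 1) * (h (leftInv β x) / mapDeriv β (leftInv β x)))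
      (Ioc 0 1) := by
  have key : ∀ x ∈ Ioc (0 : ℝ) 1, x ^ (α + 1) * (h (leftInv β x) / mapDeriv β (leftInv β x)) =
      (leftInv β x ^ (α + 1) * h (leftInv β x)) * ((1 + displacement β (leftInv β x)) ^ (α + 1) /
        (1 + (1 + β) * displacement β (leftInv β x))) := by
    intro x hx
    have hm := leftInv_mem hβ hx
    have hd := displacement_nonneg (β := β) hm.1.le
    rw [mapDeriv_of_le hm.1 hm.2]
    conv_lhs => rw [show x ^ (α + 1) = (leftInv β x * (1 + displacement β (leftInv β x))) ^ (α + 1)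
      by rw [← leftInv_eq hβ hx]]
    rw [Real.mul_rpow hm.1.le (by linarith)]
    ring
  intro x hx x' hx' hxx
  have hm := leftInv_mem hβ hx
  have hm' := leftInv_mem hβ hx'
  have hle := leftInv_mono hβ hx hx' hxx
  have hd := displacement_nonneg (β := β) hm.1.le
  have hi : leftInv β x ∈ Ioc (0 : ℝ) 1 := ⟨hm.1, hm.2.trans (by norm_num)⟩
  have hi' : leftInv β x' ∈ Ioc (0 : ℝ) 1 := ⟨hm'.1, hm'.2.trans (by norm_num)⟩
  simp only [key x hx, key x' hx']
  have := hm'.1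
  have := hh.nonneg _ hi'
  refine mul_le_mul (hh.mono hi hi' hle)
    (left_weight_mono hβ hβα hd (displacement_mono hβ.le hm.1.le hle)) (by positivity)
    (by positivity)

lemma left_term_anti {α β : ℝ} {h : ℝ → ℝ} (hβ : 0 < β) (hh : ShapeCone α h) :
    AntitoneOn (fun x => h (leftInv β x) / mapDeriv β (leftInv β x)) (Ioc 0 1) := by
  intro x hx x' hx' hxx
  have hm := leftInv_mem hβ hx
  have hm' := leftInv_mem hβ hx'
  have hle := leftInv_mono hβ hx hx' hxx
  have hi : leftInv β x ∈ Ioc (0 : ℝ) 1 := ⟨hm.1, hm.2.trans (by norm_num)⟩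
  have hi' : leftInv β x' ∈ Ioc (0 : ℝ) 1 := ⟨hm'.1, hm'.2.trans (by norm_num)⟩
  refine div_le_div₀ (hh.nonneg _ hi) (hh.anti hi hi' hle) (mapDeriv_pos hβ hm.1) ?_
  rw [mapDeriv_of_le hm.1 hm.2, mapDeriv_of_le hm'.1 hm'.2]
  have := displacement_mono hβ.le hm.1.le hle
  gcongr

/-- With `y = (x + 2) / 3` the right preimage of `x`, the function `(x / y) ^ p` increases at least
`2/3` times as fast as `x ^ p`. -/
lemma right_branch_gain {p : ℝ} (hp : 1 ≤ p) :
    MonotoneOn (fun x : ℝ => (3 * x / (x + 2)) ^ p - 2 / 3 * x ^ p) (Ioc 0 1) := by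
  have hd : ∀ x ∈ Ioc (0 : ℝ) 1, HasDerivAt (fun x : ℝ => (3 * x / (x + 2)) ^ p - 2 / 3 * x ^ p)
      (6 / (x + 2) ^ 2 * p * (3 * x / (x + 2)) ^ (p - 1) - 2 / 3 * (p * x ^ (p - 1))) x := by
    intro x hx
    have hx0 := hx.1
    have h1 : HasDerivAt (fun x : ℝ => 3 * x / (x + 2)) (6 / (x + 2) ^ 2) x := by
      refine (((hasDerivAt_id x).const_mul 3).div ((hasDerivAt_id x).add_const 2)
        (by simp only [id]; positivity)).congr_deriv ?_
      simp only [id]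
      congr 1
      ring
    exact (h1.rpow_const (Or.inr hp)).sub ((Real.hasDerivAt_rpow_const (Or.inr hp)).const_mul _)
  refine monotoneOn_of_deriv_nonneg (convex_Ioc 0 1)
    (fun x hx => (hd x hx).continuousAt.continuousWithinAt)
    (fun x hx => (hd x (interior_subset hx)).differentiableAt.differentiableWithinAt) ?_
  intro x hx
  have hx := interior_subset hx
  have hx0 := hx.1
  rw [(hd x hx).deriv]
  have h1 : x ^ (p - 1) ≤ (3 * x / (x + 2)) ^ (p - 1) := by
    refine Real.rpow_le_rpow hx0.le ?_ (by linarith)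
    rw [le_div_iff₀ (by linarith)]
    nlinarith [hx.2]
  have h2 : 2 / 3 ≤ 6 / (x + 2) ^ 2 := by
    rw [div_le_div_iff₀ (by norm_num) (by positivity)]
    nlinarith [hx.2]
  have h3 : 2 / 3 * (p * x ^ (p - 1)) ≤ 6 / (x + 2) ^ 2 * (p * (3 * x / (x + 2)) ^ (p - 1)) :=
    mul_le_mul h2 (by gcongr) (by positivity) (by positivity)
  nlinarith

/-- The right branch leaves strict room in the cone: its contribution to the transfer operator
remains in the cone after a constant comparable with `h 1` is subtracted. -/
lemma right_term_sub_mono {α c : ℝ} {h : ℝ → ℝ} (hα : 0 < α) (hα1 : α < 1) (hh : ShapeCone α h)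
    (hc0 : 0 ≤ c) (hc : 12 * c ≤ h 1) :
    MonotoneOn (fun x => x ^ (α + 1) * (h ((x + 2) / 3) / 3 - c)) (Ioc 0 1) := by
  have hmem : ∀ x ∈ Ioc (0 : ℝ) 1, (x + 2) / 3 ∈ Ioc (0 : ℝ) 1 := fun x hx =>
    ⟨by linarith [hx.1], by linarith [hx.2]⟩
  have key : ∀ x ∈ Ioc (0 : ℝ) 1, x ^ (α + 1) * (h ((x + 2) / 3) / 3 - c) =
      (3 * x / (x + 2)) ^ (α + 1) * (((x + 2) / 3) ^ (α + 1) * h ((x + 2) / 3)) / 3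
        - c * x ^ (α + 1) := by
    intro x hx
    have hx0 := hx.1
    have : x ^ (α + 1) = (3 * x / (x + 2)) ^ (α + 1) * ((x + 2) / 3) ^ (α + 1) := by
      rw [← Real.mul_rpow (by positivity) (by positivity)]
      congr 1
      field_simp
    linear_combination (h ((x + 2) / 3) / 3) * this
  intro x hx x' hx' hxx
  simp only [key x hx, key x' hx']
  have hx0 := hx.1
  have hx0' := hx'.1
  set H := ((x + 2) / 3) ^ (α + 1) * h ((x + 2) / 3) with hH
  set H' := ((x' + 2) / 3) ^ (α + 1) * h ((x' + 2) / 3) with hH'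
  have hHH : H ≤ H' := hh.mono (hmem x hx) (hmem x' hx') (by linarith)
  have hHc : 9 / 2 * c ≤ H := by
    have h1 : (4 / 9 : ℝ) ≤ ((x + 2) / 3) ^ (α + 1) := by
      calc (4 / 9 : ℝ) = (2 / 3) ^ (2 : ℝ) := by norm_num
        _ ≤ (2 / 3) ^ (α + 1) :=
          Real.rpow_le_rpow_of_exponent_ge (by norm_num) (by norm_num) (by linarith)
        _ ≤ _ := by gcongr; linarith
    have h2 : h 1 ≤ h ((x + 2) / 3) :=
      hh.anti (hmem x hx) ⟨one_pos, le_rfl⟩ (hmem x hx).2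
    have h3 : 4 / 9 * (12 * c) ≤ H := mul_le_mul h1 (hc.trans h2) (by positivity) (by positivity)
    linarith
  have hg := right_branch_gain (p := α + 1) (by linarith) hx hx' hxx
  simp only at hg
  have hpow : x ^ (α + 1) ≤ x' ^ (α + 1) := by gcongr
  have hA : 0 ≤ (3 * x' / (x' + 2)) ^ (α + 1) := by positivity
  nlinarith [mul_le_mul_of_nonneg_left hHH hA, mul_le_mul_of_nonneg_left hg (by linarith : 0 ≤ H),
    mul_le_mul_of_nonneg_right hHc (sub_nonneg.2 hpow)]

lemma shapeCone_transfer_sub {α β c : ℝ} {h : ℝ → ℝ} (hβ : 0 < β) (hβα : β ≤ α) (hα1 : α < 1)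
    (hh : ShapeCone α h) (hc0 : 0 ≤ c) (hc : 12 * c ≤ h 1) :
    ShapeCone α (fun x => transfer β h x - c) := by
  have hmem : ∀ x ∈ Ioc (0 : ℝ) 1, (x + 2) / 3 ∈ Ioc (0 : ℝ) 1 := fun x hx =>
    ⟨by linarith [hx.1], by linarith [hx.2]⟩
  constructor
  · intro x hx
    have hm := leftInv_mem hβ hx
    have h1 := hh.nonneg _ ⟨hm.1, hm.2.trans (by norm_num)⟩
    have h2 : h 1 ≤ h ((x + 2) / 3) :=
      hh.anti (hmem x hx) ⟨one_pos, le_rfl⟩ (hmem x hx).2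
    have h3 := div_nonneg h1 (mapDeriv_pos hβ hm.1).le
    rw [transfer_eq hβ hx]
    linarith
  · intro x hx x' hx' hxx
    have h1 := left_term_anti hβ hh hx hx' hxx
    have h2 := hh.anti (hmem x hx) (hmem x' hx') (by linarith)
    simp only [transfer_eq hβ hx, transfer_eq hβ hx'] at h1 ⊢
    linarith
  · intro x hx x' hx' hxx
    have h1 := left_term_mono hβ hβα hh hx hx' hxx
    have h2 := right_term_sub_mono (hβ.trans_le hβα) hα1 hh hc0 hc hx hx' hxx
    simp only [transfer_eq hβ hx, transfer_eq hβ hx'] at h1 h2 ⊢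
    linarith

/-! ### Tame densities -/

/-- The left branch contracts the bound `x ^ (-α)` by a definite amount: with `u` the displacement,
`y ^ (-α)` divided by the derivative is at most `x ^ (-α) * (1 - (1 - α) * u / (1 + u))`, and
`x ^ (-α) * u` is bounded below when `β ≤ α`, so the gain is a constant that does not depend on `x`. -/
lemma rpow_neg_div_deriv_le {α β y : ℝ} (hβ : 0 < β) (hβα : β ≤ α) (hα1 : α < 1) (hy : 0 < y)
    (hy' : y ≤ 2 / 3) :
    y ^ (-α) / (1 + (1 + β) * displacement β y) ≤
      (y * (1 + displacement β y)) ^ (-α) - (1 - α) / 3 := by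
  have hα : 0 < α := hβ.trans_le hβα
  have hu0 := displacement_nonneg (β := β) hy.le
  have hu1 := displacement_le_half hβ.le hy.le hy'
  set u := displacement β y with hu
  set x := y * (1 + u) with hx
  have hx0 : 0 < x := by positivity
  have hyx : y ^ (-α) = x ^ (-α) * (1 + u) ^ α := by
    rw [hx, Real.mul_rpow hy.le (by linarith), mul_assoc, ← Real.rpow_add (by linarith)]
    simp
  have hbern : (1 + u) ^ α ≤ 1 + α * u :=
    rpow_one_add_le_one_add_mul_self (by linarith) hα.le hα1.le
  have hxu : 1 / 2 ≤ x ^ (-α) * u := by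
    have h1 : x ^ α ≤ (3 / 2 * y) ^ β := by
      calc x ^ α ≤ (3 / 2 * y) ^ α := by
            refine Real.rpow_le_rpow hx0.le ?_ hα.le
            rw [hx]; nlinarith
        _ ≤ (3 / 2 * y) ^ β :=
            Real.rpow_le_rpow_of_exponent_ge (by positivity) (by linarith) hβα
    have h2 : x ^ (-α) * x ^ α = 1 := by rw [← Real.rpow_add hx0]; simp
    have h3 : 0 ≤ x ^ (-α) := by positivity
    have h4 : u = 1 / 2 * (3 / 2 * y) ^ β := hu
    rw [h4]
    nlinarith [mul_le_mul_of_nonneg_left h1 h3]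
  have hX : 0 ≤ x ^ (-α) := by positivity
  rw [div_le_iff₀ (by positivity), hyx]
  have h1 : x ^ (-α) * (1 + u) ^ α ≤ x ^ (-α) * (1 + α * u) := by gcongr
  refine h1.trans ?_
  have hβu : 0 ≤ β * u := by positivity
  have hle : (1 - α) / 3 ≤ x ^ (-α) := by
    have : 1 / 2 ≤ x ^ (-α) := by nlinarith
    linarith
  have h5 : (x ^ (-α) - (1 - α) / 3) * (1 + u) ≤
      (x ^ (-α) - (1 - α) / 3) * (1 + (1 + β) * u) := by
    refine mul_le_mul_of_nonneg_left (by linarith) (by linarith)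
  refine le_trans ?_ h5
  nlinarith [mul_le_mul_of_nonneg_left hxu (sub_nonneg.2 hα1.le),
    mul_le_mul_of_nonneg_left hu1 (sub_nonneg.2 hα1.le)]

lemma integrableOn_rpow_neg {α δ : ℝ} (hα1 : α < 1) (hδ : 0 ≤ δ) :
    IntegrableOn (fun x : ℝ => x ^ (-α)) (Ioc 0 δ) :=
  (intervalIntegrable_iff_integrableOn_Ioc_of_le hδ).1
    (intervalIntegral.intervalIntegrable_rpow' (by linarith))

lemma integral_rpow_neg {α δ : ℝ} (hα1 : α < 1) (hδ : 0 ≤ δ) :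
    ∫ x in Ioc 0 δ, x ^ (-α) = δ ^ (1 - α) / (1 - α) := by
  rw [← intervalIntegral.integral_of_le hδ, integral_rpow (Or.inl (by linarith)),
    Real.zero_rpow (by linarith), sub_zero, show -α + 1 = 1 - α by ring]

lemma integral_le_of_le_rpow {α B δ : ℝ} {h : ℝ → ℝ} (hα1 : α < 1) (hδ : 0 ≤ δ) (hδ1 : δ ≤ 1)
    (hi : IntegrableOn h (Ioc 0 1)) (hB : ∀ x ∈ Ioc (0 : ℝ) 1, h x ≤ B * x ^ (-α)) :
    ∫ x in Ioc 0 δ, h x ≤ B * (δ ^ (1 - α) / (1 - α)) := by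
  rw [← integral_rpow_neg hα1 hδ, ← integral_const_mul]
  exact setIntegral_mono_on (hi.mono_set (Ioc_subset_Ioc_right hδ1))
    ((integrableOn_rpow_neg hα1 hδ).const_mul B) measurableSet_Ioc
    fun x hx => hB x ⟨hx.1, hx.2.trans hδ1⟩

/-- A tame density is bounded below by a multiple of its mass: the bound `A * m * x ^ (-α)` keeps
half of the mass away from `0`, and `x ^ (α + 1) * h x` is increasing. -/
lemma exists_le_apply_one {α A : ℝ} (hα : 0 < α) (hα1 : α < 1) (hA : 1 ≤ A) :
    ∃ κ : ℝ, 0 < κ ∧ ∀ ε m : ℝ, ∀ h : ℝ → ℝ, TameDensity α A ε m h → κ * m ≤ h 1 := by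
  -- The mass of the bound `A * m * x ^ (-α)` on `(0, δ]` is exactly `m / 2`.
  set δ : ℝ := ((1 - α) / (2 * A)) ^ (1 / (1 - α)) with hδ
  have hq : 0 < (1 - α) / (2 * A) := div_pos (by linarith) (by linarith)
  have hδ0 : 0 < δ := Real.rpow_pos_of_pos hq _
  have hδ1 : δ ≤ 1 := by
    refine Real.rpow_le_one hq.le ?_ (by rw [one_div]; exact inv_nonneg.2 (by linarith))
    rw [div_le_one (by linarith)]
    linarith
  have hδp : δ ^ (1 - α) = (1 - α) / (2 * A) := by
    rw [hδ, ← Real.rpow_mul hq.le, one_div_mul_cancel (by linarith), Real.rpow_one]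
  have hD : 0 < δ ^ (α + 1) := Real.rpow_pos_of_pos hδ0 _
  refine ⟨δ ^ (α + 1) / 2, by positivity, fun ε m h hh => ?_⟩
  have h1mem : (1 : ℝ) ∈ Ioc (0 : ℝ) 1 := ⟨one_pos, le_rfl⟩
  have hδmem : δ ∈ Ioc (0 : ℝ) 1 := ⟨hδ0, hδ1⟩
  have h1 : ∫ x in Ioc 0 δ, h x ≤ m / 2 := by
    refine (integral_le_of_le_rpow hα1 hδ0.le hδ1 hh.integrable hh.le_rpow).trans (le_of_eq ?_)
    rw [hδp]
    have : 1 - α ≠ 0 := by linarith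
    field_simp
  have h2 : ∫ x in Ioc δ 1, h x ≤ h δ := by
    have hle : ∫ x in Ioc δ 1, h x ≤ ∫ x in Ioc δ 1, h δ :=
      setIntegral_mono_on (hh.integrable.mono_set (Ioc_subset_Ioc_left hδ0.le))
        (integrableOn_const (by simp)) measurableSet_Ioc
        fun x hx => hh.anti hδmem ⟨hδ0.trans hx.1, hx.2⟩ hx.1.le
    refine hle.trans ?_
    rw [setIntegral_const, Real.volume_real_Ioc_of_le hδ1, smul_eq_mul]
    nlinarith [hh.nonneg δ hδmem]
  have h3 : δ ^ (α + 1) * h δ ≤ h 1 := by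
    simpa using hh.mono hδmem h1mem hδ1
  have h4 : m = (∫ x in Ioc 0 δ, h x) + ∫ x in Ioc δ 1, h x := by
    rw [← hh.integral_eq, ← setIntegral_union (Ioc_disjoint_Ioc_of_le le_rfl) measurableSet_Ioc
      (hh.integrable.mono_set (Ioc_subset_Ioc_right hδ1))
      (hh.integrable.mono_set (Ioc_subset_Ioc_left hδ0.le)),
      Ioc_union_Ioc_eq_Ioc hδ0.le hδ1]
  have h5 : m / 2 ≤ h δ := by linarith
  nlinarith [mul_le_mul_of_nonneg_left h5 hD.le]

lemma apply_two_thirds_le {α A ε m : ℝ} {h : ℝ → ℝ} (hh : TameDensity α A ε m h) :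
    h (2 / 3) ≤ 3 / 2 * m := by
  have hmem : (2 / 3 : ℝ) ∈ Ioc (0 : ℝ) 1 := ⟨by norm_num, by norm_num⟩
  have h1 : ∫ x in Ioc (0 : ℝ) (2 / 3), h (2 / 3) ≤ ∫ x in Ioc (0 : ℝ) (2 / 3), h x :=
    setIntegral_mono_on (integrableOn_const (by simp))
      (hh.integrable.mono_set (Ioc_subset_Ioc_right (by norm_num))) measurableSet_Ioc
      fun x hx => hh.anti ⟨hx.1, hx.2.trans (by norm_num)⟩ hmem hx.2
  have h2 : ∫ x in Ioc (0 : ℝ) (2 / 3), h x ≤ m := by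
    rw [← hh.integral_eq]
    exact setIntegral_mono_set hh.integrable
      ((ae_restrict_iff' measurableSet_Ioc).2 (Filter.Eventually.of_forall hh.nonneg))
      (Ioc_subset_Ioc_right (by norm_num : (2 / 3 : ℝ) ≤ 1)).eventuallyLE
  rw [setIntegral_const, Real.volume_real_Ioc_of_le (by norm_num), smul_eq_mul] at h1
  linarith

lemma transfer_le_of_tame {α β A ε m x : ℝ} {h : ℝ → ℝ} (hβ : 0 < β)
    (hh : TameDensity α A ε m h) (hx : x ∈ Ioc (0 : ℝ) 1) :
    transfer β h x ≤ h (leftInv β x) / (1 + (1 + β) * displacement β (leftInv β x)) + m / 2 := by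
  have hm := leftInv_mem hβ hx
  have h1 : h ((x + 2) / 3) ≤ h (2 / 3) :=
    hh.anti ⟨by norm_num, by norm_num⟩ ⟨by linarith [hx.1], by linarith [hx.2]⟩
      (by linarith [hx.1])
  have h2 := apply_two_thirds_le hh
  rw [transfer_eq hβ hx, mapDeriv_of_le hm.1 hm.2]
  linarith

/-- A density of the cone that obeys the tame bound on `[ε, 1]` is replaced by a tame one of the
same mass, by cutting it at a height `M` and spreading the excess uniformly. Both operations preserve
the shape, and the cost in `L¹` is at most twice the excess. -/
lemma exists_tame_approx {α A ε m d : ℝ} {g : ℝ → ℝ} (hα : 0 < α) (hA : 1 ≤ A) (hε : 0 < ε)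
    (hε1 : ε ≤ 1) (hg : ShapeCone α g) (hi : IntegrableOn g (Ioc 0 1))
    (hm : ∫ x in Ioc (0 : ℝ) 1, g x = m)
    (hfar : ∀ x ∈ Ioc (0 : ℝ) 1, ε ≤ x → g x ≤ (A * x ^ (-α) - 1) * m)
    (hnear : ∫ x in Ioc 0 ε, max (g x - (A * ε ^ (-α) - 1) * m) 0 ≤ d) :
    ∃ h : ℝ → ℝ, TameDensity α A ε m h ∧ ∫ x in Ioc (0 : ℝ) 1, |g x - h x| ≤ 2 * d := by
  have hm0 : 0 ≤ m := hm ▸ setIntegral_nonneg measurableSet_Ioc hg.nonneg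
  have hεα : 1 ≤ ε ^ (-α) := Real.one_le_rpow_of_pos_of_le_one_of_nonpos hε hε1 (by linarith)
  set M := (A * ε ^ (-α) - 1) * m with hM
  have hM0 : 0 ≤ M := mul_nonneg (by nlinarith) hm0
  have hpow : ∀ x, 0 < x → x ≤ ε → ε ^ (-α) ≤ x ^ (-α) := fun x hx hxε =>
    Real.rpow_le_rpow_of_nonpos hx hxε (by linarith)
  have hpow' : ∀ x, ε ≤ x → x ^ (-α) ≤ ε ^ (-α) := fun x hx =>
    Real.rpow_le_rpow_of_nonpos hε hx (by linarith)
  have hconst : IntegrableOn (fun _ : ℝ => M) (Ioc 0 1) := integrableOn_const (by simp)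
  have hexc : IntegrableOn (fun x => max (g x - M) 0) (Ioc 0 1) := (hi.sub hconst).pos_part
  set e := ∫ x in Ioc (0 : ℝ) 1, max (g x - M) 0 with he
  have he0 : 0 ≤ e := setIntegral_nonneg measurableSet_Ioc fun x _ => le_max_right _ _
  have hed : e ≤ d := by
    refine le_trans (le_of_eq ?_) hnear
    refine setIntegral_eq_of_subset_of_forall_sdiff_eq_zero measurableSet_Ioc
      (Ioc_subset_Ioc_right hε1) fun x hx => ?_
    have hxε : ε ≤ x := by
      by_contra hlt
      exact hx.2 ⟨hx.1.1, (not_le.1 hlt).le⟩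
    refine max_eq_right (sub_nonpos.2 ((hfar x hx.1 hxε).trans ?_))
    have := hpow' x hxε
    rw [hM]
    gcongr
  have hem : e ≤ m := by
    rw [← hm]
    exact setIntegral_mono_on hexc hi measurableSet_Ioc
      fun x hx => max_le (by linarith) (hg.nonneg x hx)
  have hmin : ∀ x, min (g x) M + e = g x - max (g x - M) 0 + e := by
    intro x
    rcases le_total (g x) M with h | h
    · rw [min_eq_left h, max_eq_right (by linarith)]; ring
    · rw [min_eq_right h, max_eq_left (by linarith)]; ring
  have hcap : ∀ x ∈ Ioc (0 : ℝ) 1, min (g x) M + e ≤ A * m * ε ^ (-α) := by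
    intro x _
    have := min_le_right (g x) M
    have : M = A * m * ε ^ (-α) - m := by rw [hM]; ring
    linarith
  have hce : IntegrableOn (fun _ : ℝ => e) (Ioc 0 1) := integrableOn_const (by simp)
  refine ⟨fun x => min (g x) M + e, ⟨⟨?_, ?_, ?_⟩, ?_, ?_, ?_, hcap⟩, ?_⟩
  · intro x hx
    have := le_min (hg.nonneg x hx) hM0
    linarith
  · intro x hx y hy hxy
    have := min_le_min_right M (hg.anti hx hy hxy)
    simpa using this
  · intro x hx y hy hxy
    have hx0 := hx.1
    have h1 := hg.mono hx hy hxy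
    have h2 : x ^ (α + 1) ≤ y ^ (α + 1) := by gcongr
    have hX : 0 ≤ x ^ (α + 1) := by positivity
    have hY : 0 ≤ y ^ (α + 1) := hX.trans h2
    simp only [mul_add, mul_min_of_nonneg _ _ hX, mul_min_of_nonneg _ _ hY]
    exact add_le_add (min_le_min h1 (by gcongr)) (by gcongr)
  · exact (hi.inf hconst).add hce
  · simp only [hmin]
    have hsub : IntegrableOn (fun x => g x - max (g x - M) 0) (Ioc 0 1) := hi.sub hexc
    rw [integral_add hsub hce, integral_sub hi hexc, ← he, hm, setIntegral_const,
      Real.volume_real_Ioc_of_le zero_le_one]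
    simp
  · intro x hx
    rcases le_total ε x with h | h
    · have h1 := hfar x hx h
      have h2 := min_le_left (g x) M
      nlinarith
    · refine (hcap x hx).trans ?_
      have := hpow x hx.1 h
      gcongr
  · have h1 : ∀ x ∈ Ioc (0 : ℝ) 1, |g x - (min (g x) M + e)| ≤ max (g x - M) 0 + e := by
      intro x _
      rw [hmin, abs_le]
      have := le_max_right (g x - M) 0
      constructor <;> linarith
    calc ∫ x in Ioc (0 : ℝ) 1, |g x - (min (g x) M + e)|
        ≤ ∫ x in Ioc (0 : ℝ) 1, (max (g x - M) 0 + e) :=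
          setIntegral_mono_on (hi.sub ((hi.inf hconst).add hce)).abs (hexc.add hce)
            measurableSet_Ioc h1
      _ = 2 * e := by
          rw [integral_add hexc hce, setIntegral_const, Real.volume_real_Ioc_of_le zero_le_one,
            ← he]
          simp
          ring
      _ ≤ 2 * d := by linarith

/-- One iteration: a tame density of mass `m` can give up the constant `θ * ε ^ α * m` after a
transfer operator is applied, and what is left is tame again up to an error `O(m * ε)` in `L¹`. -/
lemma exists_tame_transfer {α β A θ ε m : ℝ} {h : ℝ → ℝ} (hβ : 0 < β) (hβα : β ≤ α) (hα1 : α < 1)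
    (hA : 9 / (1 - α) ≤ A) (hθ : 0 < θ) (hθα : θ ≤ (1 - α) / 6) (hε : 0 < ε) (hε1 : ε ≤ 1)
    (hh : TameDensity α A ε m h) (hlow : 12 * (θ * m) ≤ h 1) :
    ∃ h' : ℝ → ℝ, TameDensity α A ε ((1 - θ * ε ^ α) * m) h' ∧
      ∫ x in Ioc (0 : ℝ) 1, |transfer β h x - θ * ε ^ α * m - h' x| ≤ 2 * ((2 + A) * m * ε) := by
  have hα : 0 < α := hβ.trans_le hβα
  have hA' : 9 ≤ A * (1 - α) := (div_le_iff₀ (by linarith)).1 hA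
  have hA1 : 1 ≤ A := by nlinarith
  have hm0 : 0 ≤ m := hh.integral_eq ▸ setIntegral_nonneg measurableSet_Ioc hh.nonneg
  have hεα0 : 0 < ε ^ α := by positivity
  have hεα1 : ε ^ α ≤ 1 := Real.rpow_le_one hε.le hε1 hα.le
  have hinv : ε ^ α * ε ^ (-α) = 1 := by rw [← Real.rpow_add hε]; simp
  set κ := θ * ε ^ α with hκ
  have hκ0 : 0 < κ := by positivity
  have hκθ : κ ≤ θ := by nlinarith
  have hκ1 : κ ≤ 1 := by linarith
  have hcone : ShapeCone α (fun x => transfer β h x - κ * m) :=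
    shapeCone_transfer_sub hβ hβα hα1 hh.toShapeCone (by positivity)
      (le_trans (by gcongr) hlow)
  have hci : IntegrableOn (fun _ : ℝ => κ * m) (Ioc 0 1) := integrableOn_const (by simp)
  have hPi := integrableOn_transfer hβ hh.integrable
  refine exists_tame_approx (d := (2 + A) * m * ε) hα hA1 hε hε1 hcone (hPi.sub hci) ?_ ?_ ?_
  · rw [integral_sub hPi hci, integral_transfer hβ hh.integrable, hh.integral_eq,
      setIntegral_const, Real.volume_real_Ioc_of_le zero_le_one]
    simp
    ring
  · intro x hx hxε
    have hm := leftInv_mem hβ hx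
    have hd := displacement_nonneg (β := β) hm.1.le
    have hle := transfer_le_of_tame hβ hh hx
    have hb := rpow_neg_div_deriv_le hβ hβα hα1 hm.1 hm.2
    rw [← leftInv_eq hβ hx] at hb
    have h1 : h (leftInv β x) / (1 + (1 + β) * displacement β (leftInv β x)) ≤
        A * m * (x ^ (-α) - (1 - α) / 3) := by
      refine le_trans ?_ (mul_le_mul_of_nonneg_left hb (by positivity))
      rw [← mul_div_assoc]
      exact div_le_div_of_nonneg_right (hh.le_rpow _ ⟨hm.1, hm.2.trans (by norm_num)⟩)
        (by positivity)
    have h2 : κ * x ^ (-α) ≤ θ := by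
      have : x ^ (-α) ≤ ε ^ (-α) := Real.rpow_le_rpow_of_nonpos hε hxε (by linarith)
      calc κ * x ^ (-α) ≤ κ * ε ^ (-α) := by gcongr
        _ = θ := by rw [hκ, mul_assoc, hinv, mul_one]
    have h3 : A * (κ * x ^ (-α)) ≤ A * (1 - α) / 6 := by
      calc A * (κ * x ^ (-α)) ≤ A * ((1 - α) / 6) := by gcongr; exact h2.trans hθα
        _ = _ := by ring
    -- The gain `A * (1 - α) / 3` of the left branch, at least `3` as `9 ≤ A * (1 - α)`, pays for the
    -- loss of mass (half of the gain), for the right branch (`1 / 2`) and for the slack `1` that the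
    -- truncation needs.
    have h4 : 0 ≤ m * (A * (1 - α) / 3 - A * (κ * x ^ (-α)) - 3 / 2) :=
      mul_nonneg hm0 (by linarith)
    have h5 : 0 ≤ κ * m := by positivity
    nlinarith
  -- The operator does not increase the cap except through the right branch, so the excess over the
  -- new cap has height `O(m)`, because `κ * ε ^ (-α) = θ`.
  · have hub : ∀ x ∈ Ioc 0 ε, max (transfer β h x - κ * m - (A * ε ^ (-α) - 1) * ((1 - κ) * m)) 0 ≤
        (2 + A) * m := by
      intro x hx
      have hx1 : x ∈ Ioc (0 : ℝ) 1 := ⟨hx.1, hx.2.trans hε1⟩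
      have hm := leftInv_mem hβ hx1
      have hd := displacement_nonneg (β := β) hm.1.le
      have hmem : leftInv β x ∈ Ioc (0 : ℝ) 1 := ⟨hm.1, hm.2.trans (by norm_num)⟩
      have hle := transfer_le_of_tame hβ hh hx1
      have h1 : h (leftInv β x) / (1 + (1 + β) * displacement β (leftInv β x)) ≤
          A * m * ε ^ (-α) := by
        refine (div_le_self (hh.nonneg _ hmem) ?_).trans (hh.le_cap _ hmem)
        have : 0 ≤ (1 + β) * displacement β (leftInv β x) := by positivity
        linarith
      have h2 : κ * ε ^ (-α) = θ := by rw [hκ, mul_assoc, hinv, mul_one]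
      have h3 : 0 ≤ κ * m := by positivity
      have h4 : A * m * (κ * ε ^ (-α)) ≤ A * m := by
        rw [h2]
        exact mul_le_of_le_one_right (by positivity) (by linarith)
      refine max_le ?_ (by positivity)
      nlinarith
    calc ∫ x in Ioc 0 ε, max (transfer β h x - κ * m - (A * ε ^ (-α) - 1) * ((1 - κ) * m)) 0
        ≤ ∫ x in Ioc 0 ε, (2 + A) * m := by
          have hMi : IntegrableOn (fun _ : ℝ => (A * ε ^ (-α) - 1) * ((1 - κ) * m)) (Ioc 0 1) :=
            integrableOn_const (by simp)
          have hexc : IntegrableOn (fun x => max (transfer β h x - κ * m -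
              (A * ε ^ (-α) - 1) * ((1 - κ) * m)) 0) (Ioc 0 1) := ((hPi.sub hci).sub hMi).pos_part
          exact setIntegral_mono_on (hexc.mono_set (Ioc_subset_Ioc_right hε1))
            (integrableOn_const (by simp)) measurableSet_Ioc hub
      _ = (2 + A) * m * ε := by
          rw [setIntegral_const, Real.volume_real_Ioc_of_le hε.le, smul_eq_mul]
          ring

/-! ### Coupling along a sequence of maps -/

lemma transfer_of_notMem {β x : ℝ} (hβ : 0 < β) (hx : x ∉ Ioc (0 : ℝ) 1) (f : ℝ → ℝ) :
    transfer β f x = 0 := by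
  have hset : {y : ℝ | y ∈ Ioc (0 : ℝ) 1 ∧ map β y = x} = ∅ := by
    refine eq_empty_of_forall_notMem fun y ⟨hy, hyx⟩ => hx ?_
    rw [← hyx]
    rcases le_or_gt y (2 / 3) with h | h
    · rw [← image_map_left hβ]
      exact mem_image_of_mem _ ⟨hy.1, h⟩
    · rw [map_right h]
      exact ⟨by linarith, by linarith [hy.2]⟩
  rw [transfer, hset, finsum_mem_empty]

lemma transferSeq_sub {β : ℕ → ℝ} {n : ℕ} (hβ : ∀ k, 1 ≤ k → k ≤ n → 0 < β k) (f g : ℝ → ℝ) :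
    transferSeq β n (fun x => f x - g x) =
      fun x => transferSeq β n f x - transferSeq β n g x := by
  induction n with
  | zero => rfl
  | succ n ih =>
    have hpos := hβ (n + 1) (by omega) le_rfl
    funext x
    simp only [transferSeq, ih fun k h1 h2 => hβ k h1 (by omega)]
    by_cases hx : x ∈ Ioc (0 : ℝ) 1
    · exact transfer_sub hpos hx _ _
    · simp [transfer_of_notMem hpos hx]

lemma integrableOn_transferSeq {β : ℕ → ℝ} {n : ℕ} (hβ : ∀ k, 1 ≤ k → k ≤ n → 0 < β k)
    {f : ℝ → ℝ} (hf : IntegrableOn f (Ioc 0 1)) : IntegrableOn (transferSeq β n f) (Ioc 0 1) := by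
  induction n with
  | zero => exact hf
  | succ n ih =>
    exact integrableOn_transfer (hβ (n + 1) (by omega) le_rfl)
      (ih fun k h1 h2 => hβ k h1 (by omega))

lemma integral_abs_transferSeq_le {β : ℕ → ℝ} {n : ℕ} (hβ : ∀ k, 1 ≤ k → k ≤ n → 0 < β k)
    {f : ℝ → ℝ} (hf : IntegrableOn f (Ioc 0 1)) :
    ∫ x in Ioc (0 : ℝ) 1, |transferSeq β n f x| ≤ ∫ x in Ioc (0 : ℝ) 1, |f x| := by
  induction n with
  | zero => exact le_rfl
  | succ n ih =>
    have hβ' : ∀ k, 1 ≤ k → k ≤ n → 0 < β k := fun k h1 h2 => hβ k h1 (by omega)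
    exact (integral_abs_transfer_le (hβ (n + 1) (by omega) le_rfl)
      (integrableOn_transferSeq hβ' hf)).trans (ih hβ')

lemma integral_abs_sub_le {f g : ℝ → ℝ} (hf : IntegrableOn f (Ioc 0 1))
    (hg : IntegrableOn g (Ioc 0 1)) :
    ∫ x in Ioc (0 : ℝ) 1, |f x - g x| ≤
      (∫ x in Ioc (0 : ℝ) 1, |f x|) + ∫ x in Ioc (0 : ℝ) 1, |g x| := by
  rw [← integral_add hf.abs hg.abs]
  exact setIntegral_mono_on (hf.sub hg).abs (hf.abs.add hg.abs) measurableSet_Ioc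
    fun x _ => abs_sub _ _

lemma TameDensity.integral_abs {α A ε m : ℝ} {h : ℝ → ℝ} (hh : TameDensity α A ε m h) :
    ∫ x in Ioc (0 : ℝ) 1, |h x| = m := by
  rw [← hh.integral_eq]
  exact setIntegral_congr_fun measurableSet_Ioc fun x hx => abs_of_nonneg (hh.nonneg x hx)

/-- After `n` iterations the difference of the two images is, up to an accumulated error, the
difference of two tame densities of mass `(1 - θ * ε ^ α) ^ n * m`: the constants subtracted from the
two sides at each iteration are equal and cancel. -/
lemma exists_tame_coupling {α A θ ε m d : ℝ} {β : ℕ → ℝ} {n : ℕ} {φ ψ h₀ k₀ : ℝ → ℝ}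
    (hβ : ∀ k : ℕ, 1 ≤ k → k ≤ n → 0 < β k ∧ β k ≤ α) (hα1 : α < 1)
    (hA : 9 / (1 - α) ≤ A) (hθ : 0 < θ) (hθα : θ ≤ (1 - α) / 6) (hε : 0 < ε) (hε1 : ε ≤ 1)
    (hlow : ∀ m' h, TameDensity α A ε m' h → 12 * (θ * m') ≤ h 1)
    (hφ : IntegrableOn φ (Ioc 0 1)) (hψ : IntegrableOn ψ (Ioc 0 1))
    (hh₀ : TameDensity α A ε m h₀) (hk₀ : TameDensity α A ε m k₀)
    (hφh : ∫ x in Ioc (0 : ℝ) 1, |φ x - h₀ x| ≤ d) (hψk : ∫ x in Ioc (0 : ℝ) 1, |ψ x - k₀ x| ≤ d) :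
    ∃ h k : ℝ → ℝ, TameDensity α A ε ((1 - θ * ε ^ α) ^ n * m) h ∧
      TameDensity α A ε ((1 - θ * ε ^ α) ^ n * m) k ∧
      ∫ x in Ioc (0 : ℝ) 1, |(transferSeq β n φ x - transferSeq β n ψ x) - (h x - k x)| ≤
        2 * d + 4 * (2 + A) * m * ε * ((1 - (1 - θ * ε ^ α) ^ n) / (θ * ε ^ α)) := by
  induction n with
  | zero =>
    refine ⟨h₀, k₀, by simpa using hh₀, by simpa using hk₀, ?_⟩
    have h1 := integral_abs_sub_le (hφ.sub hh₀.integrable) (hψ.sub hk₀.integrable)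
    have h2 : ∀ x, φ x - ψ x - (h₀ x - k₀ x) = φ x - h₀ x - (ψ x - k₀ x) := fun x => by ring
    simp only [Pi.sub_apply] at h1
    simp only [transferSeq, h2, pow_zero, sub_self, zero_div, mul_zero, add_zero]
    linarith
  | succ n ih =>
    have hβ' : ∀ k : ℕ, 1 ≤ k → k ≤ n → 0 < β k ∧ β k ≤ α := fun k h1 h2 => hβ k h1 (by omega)
    have hpos : ∀ k : ℕ, 1 ≤ k → k ≤ n → 0 < β k := fun k h1 h2 => (hβ' k h1 h2).1
    obtain ⟨hb, hbα⟩ := hβ (n + 1) (by omega) le_rfl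
    obtain ⟨h, k, hh, hk, hhk⟩ := ih hβ'
    set κ := θ * ε ^ α with hκ
    have hκ0 : 0 < κ := by positivity
    set μ := (1 - κ) ^ n * m with hμ
    obtain ⟨h', hh', hhe⟩ := exists_tame_transfer hb hbα hα1 hA hθ hθα hε hε1 hh (hlow _ _ hh)
    obtain ⟨k', hk', hke⟩ := exists_tame_transfer hb hbα hα1 hA hθ hθα hε hε1 hk (hlow _ _ hk)
    have hμ' : (1 - κ) ^ (n + 1) * m = (1 - κ) * μ := by rw [hμ]; ring
    rw [hμ']
    refine ⟨h', k', hh', hk', ?_⟩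
    have hiφ := integrableOn_transferSeq hpos hφ
    have hiψ := integrableOn_transferSeq hpos hψ
    have hc : IntegrableOn (fun _ : ℝ => κ * μ) (Ioc 0 1) := integrableOn_const (by simp)
    have hPh := integrableOn_transfer hb hh.integrable
    have hPk := integrableOn_transfer hb hk.integrable
    have hdiff : IntegrableOn (fun x => (transferSeq β n φ x - transferSeq β n ψ x) - (h x - k x))
        (Ioc 0 1) := (hiφ.sub hiψ).sub (hh.integrable.sub hk.integrable)
    have hd1 := integral_abs_transfer_le hb hdiff
    have hi1 := (integrableOn_transfer hb hdiff).abs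
    have hi2 : IntegrableOn (fun x => |transfer (β (n + 1)) h x - κ * μ - h' x|) (Ioc 0 1) :=
      ((hPh.sub hc).sub hh'.integrable).abs
    have hi3 : IntegrableOn (fun x => |transfer (β (n + 1)) k x - κ * μ - k' x|) (Ioc 0 1) :=
      ((hPk.sub hc).sub hk'.integrable).abs
    have hi12 : IntegrableOn (fun x => |transfer (β (n + 1)) (fun x =>
        (transferSeq β n φ x - transferSeq β n ψ x) - (h x - k x)) x| +
        |transfer (β (n + 1)) h x - κ * μ - h' x|) (Ioc 0 1) := hi1.add hi2
    have hi0 : IntegrableOn (fun x => |(transferSeq β (n + 1) φ x - transferSeq β (n + 1) ψ x) -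
        (h' x - k' x)|) (Ioc 0 1) :=
      (((integrableOn_transfer hb hiφ).sub (integrableOn_transfer hb hiψ)).sub
        (hh'.integrable.sub hk'.integrable)).abs
    -- The constant `κ * μ` enters with both signs, so that it may be inserted in each of the two
    -- error terms.
    have hmain : ∫ x in Ioc (0 : ℝ) 1, |(transferSeq β (n + 1) φ x - transferSeq β (n + 1) ψ x) -
        (h' x - k' x)| ≤ ((∫ x in Ioc (0 : ℝ) 1, |transfer (β (n + 1)) (fun x =>
        (transferSeq β n φ x - transferSeq β n ψ x) - (h x - k x)) x|) +
        ∫ x in Ioc (0 : ℝ) 1, |transfer (β (n + 1)) h x - κ * μ - h' x|) +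
        ∫ x in Ioc (0 : ℝ) 1, |transfer (β (n + 1)) k x - κ * μ - k' x| := by
      rw [← integral_add hi1 hi2, ← integral_add hi12 hi3]
      refine setIntegral_mono_on hi0 (hi12.add hi3) measurableSet_Ioc fun x hx => ?_
      rw [transfer_sub hb hx (fun x => transferSeq β n φ x - transferSeq β n ψ x)
        (fun x => h x - k x), transfer_sub hb hx, transfer_sub hb hx]
      simp only [transferSeq]
      refine le_trans (le_of_eq ?_) ((abs_sub _ _).trans (add_le_add_left (abs_add_le _ _) _))
      congr 1
      ring
    refine hmain.trans ?_
    -- The errors form a geometric series of ratio `1 - κ`.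
    have hsum : 2 * d + 4 * (2 + A) * m * ε * ((1 - (1 - κ) ^ (n + 1)) / κ) =
        2 * d + 4 * (2 + A) * m * ε * ((1 - (1 - κ) ^ n) / κ) + 2 * (2 * ((2 + A) * μ * ε)) := by
      rw [hμ]
      field_simp
      ring
    rw [hsum]
    linarith

/-! ### The rate -/

/-- The bound obtained from the coupling at a fixed scale `ε`. -/
lemma loss_of_memory_bound {α A a θ ε m : ℝ} {β : ℕ → ℝ} {n : ℕ} {φ ψ : ℝ → ℝ} (hα : 0 < α)
    (hα1 : α < 1) (hβ : ∀ k : ℕ, 1 ≤ k → k ≤ n → 0 < β k ∧ β k ≤ α)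
    (hA : 9 / (1 - α) ≤ A) (haA : a + 1 ≤ A) (hθ : 0 < θ) (hθα : θ ≤ (1 - α) / 6) (hε : 0 < ε)
    (hε1 : ε ≤ 1) (hlow : ∀ m' h, TameDensity α A ε m' h → 12 * (θ * m') ≤ h 1)
    (hφ : φ ∈ coneTwo α a) (hψ : ψ ∈ coneTwo α a)
    (hφm : ∫ x in Ioc (0 : ℝ) 1, φ x = m) (hψm : ∫ x in Ioc (0 : ℝ) 1, ψ x = m) :
    ∫ x in Ioc (0 : ℝ) 1, |transferSeq β n φ x - transferSeq β n ψ x| ≤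
      m * ((4 * A / (1 - α) + 4 * (2 + A) / θ) * ε ^ (1 - α) + 2 * (1 - θ * ε ^ α) ^ n) := by
  have hA9 : 9 ≤ A * (1 - α) := (div_le_iff₀ (by linarith)).1 hA
  have hA1 : 1 ≤ A := by nlinarith
  have hm0 : 0 ≤ m := hφm ▸ setIntegral_nonneg measurableSet_Ioc hφ.1.2.1
  have start : ∀ f ∈ coneTwo α a, ∫ x in Ioc (0 : ℝ) 1, f x = m →
      ∃ h, TameDensity α A ε m h ∧ ∫ x in Ioc (0 : ℝ) 1, |f x - h x| ≤
        2 * (A * m * (ε ^ (1 - α) / (1 - α))) := by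
    rintro f ⟨⟨-, hf0, hfa, hfm⟩, hfi, hfb⟩ hint
    have hfb' : ∀ x ∈ Ioc (0 : ℝ) 1, f x ≤ (A * x ^ (-α) - 1) * m := by
      intro x hx
      have h1 : 1 ≤ x ^ (-α) := Real.one_le_rpow_of_pos_of_le_one_of_nonpos hx.1 hx.2 (by linarith)
      have h2 := hfb x hx
      rw [hint] at h2
      refine h2.trans (mul_le_mul_of_nonneg_right ?_ hm0)
      nlinarith
    refine exists_tame_approx hα hA1 hε hε1 ⟨hf0, hfa, hfm⟩ hfi hint (fun x hx _ => hfb' x hx) ?_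
    have hMi : IntegrableOn (fun _ : ℝ => (A * ε ^ (-α) - 1) * m) (Ioc 0 1) :=
      integrableOn_const (by simp)
    refine le_trans ?_ (integral_le_of_le_rpow hα1 hε.le hε1 hfi fun x hx => ?_)
    · have hexc : IntegrableOn (fun x => max (f x - (A * ε ^ (-α) - 1) * m) 0) (Ioc 0 1) :=
        (hfi.sub hMi).pos_part
      refine setIntegral_mono_on (hexc.mono_set (Ioc_subset_Ioc_right hε1))
        (hfi.mono_set (Ioc_subset_Ioc_right hε1)) measurableSet_Ioc fun x hx => ?_
      have h1 : 1 ≤ ε ^ (-α) := Real.one_le_rpow_of_pos_of_le_one_of_nonpos hε hε1 (by linarith)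
      have h2 : 0 ≤ (A * ε ^ (-α) - 1) * m := mul_nonneg (by nlinarith) hm0
      exact max_le (by linarith) (hf0 x ⟨hx.1, hx.2.trans hε1⟩)
    · have := hfb' x hx
      nlinarith
  obtain ⟨h₀, hh₀, hφh⟩ := start φ hφ hφm
  obtain ⟨k₀, hk₀, hψk⟩ := start ψ hψ hψm
  obtain ⟨h, k, hh, hk, hhk⟩ := exists_tame_coupling hβ hα1 hA hθ hθα hε hε1 hlow hφ.2.1 hψ.2.1
    hh₀ hk₀ hφh hψk
  have hpos : ∀ k : ℕ, 1 ≤ k → k ≤ n → 0 < β k := fun k h1 h2 => (hβ k h1 h2).1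
  have hiφ := integrableOn_transferSeq hpos hφ.2.1
  have hiψ := integrableOn_transferSeq hpos hψ.2.1
  have hfin : ∫ x in Ioc (0 : ℝ) 1, |transferSeq β n φ x - transferSeq β n ψ x| ≤
      (∫ x in Ioc (0 : ℝ) 1, |(transferSeq β n φ x - transferSeq β n ψ x) - (h x - k x)|) +
      ∫ x in Ioc (0 : ℝ) 1, |h x - k x| := by
    have hi1 : IntegrableOn (fun x => |(transferSeq β n φ x - transferSeq β n ψ x) - (h x - k x)|)
      (Ioc 0 1) := ((hiφ.sub hiψ).sub (hh.integrable.sub hk.integrable)).abs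
    have hi2 : IntegrableOn (fun x => |h x - k x|) (Ioc 0 1) :=
      (hh.integrable.sub hk.integrable).abs
    rw [← integral_add hi1 hi2]
    refine setIntegral_mono_on (hiφ.sub hiψ).abs (hi1.add hi2) measurableSet_Ioc fun x _ => ?_
    refine le_trans (le_of_eq ?_) (abs_add_le _ _)
    congr 1
    ring
  have hhk' := integral_abs_sub_le hh.integrable hk.integrable
  rw [hh.integral_abs, hk.integral_abs] at hhk'
  have hεα : 0 < ε ^ α := by positivity
  have hεα1 : ε ^ α ≤ 1 := Real.rpow_le_one hε.le hε1 hα.le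
  have hκ0 : 0 < θ * ε ^ α := by positivity
  have hκ1 : θ * ε ^ α ≤ 1 := by nlinarith
  have hgeo : 4 * (2 + A) * m * ε * ((1 - (1 - θ * ε ^ α) ^ n) / (θ * ε ^ α)) ≤
      m * (4 * (2 + A) / θ * ε ^ (1 - α)) := by
    have h1 : ε ^ (1 - α) = ε / ε ^ α := by rw [Real.rpow_sub hε, Real.rpow_one]
    have h2 : 0 ≤ (1 - θ * ε ^ α) ^ n := pow_nonneg (by linarith) n
    calc _ ≤ 4 * (2 + A) * m * ε * (1 / (θ * ε ^ α)) := by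
          gcongr
          linarith
      _ = _ := by
          rw [h1]
          field_simp
  have h1α : 1 - α ≠ 0 := by linarith
  have hlast : m * ((4 * A / (1 - α) + 4 * (2 + A) / θ) * ε ^ (1 - α) +
      2 * (1 - θ * ε ^ α) ^ n) = 2 * (2 * (A * m * (ε ^ (1 - α) / (1 - α)))) +
      m * (4 * (2 + A) / θ * ε ^ (1 - α)) + 2 * ((1 - θ * ε ^ α) ^ n * m) := by
    field_simp
    ring
  rw [hlast]
  linarith

/-- Optimization over the scale: the choice `ε ^ α = K * log n / n`, with `K` large enough for
`(1 - θ * ε ^ α) ^ n` to be at most `n ^ (1 - 1 / α)`. When `K * log n / n` exceeds `1`, the rate is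
bounded below and the trivial bound suffices. -/
lemma exists_rate_bound {α θ D : ℝ} (hα : 0 < α) (hα1 : α < 1) (hθ : 0 < θ) (hθ1 : θ ≤ 1)
    (hD : 0 ≤ D) : ∃ C : ℝ, ∀ n : ℕ, 1 < n → 2 ≤ C * rate α n ∨ ∃ ε : ℝ, 0 < ε ∧ ε ≤ 1 ∧
      D * ε ^ (1 - α) + 2 * (1 - θ * ε ^ α) ^ n ≤ C * rate α n := by
  have hγ : 0 < 1 / α - 1 := by rw [sub_pos, lt_div_iff₀ hα]; linarith
  set K := (1 / α - 1) / θ with hK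
  have hK0 : 0 < K := by positivity
  set C := 2 * K ^ (1 / α) + D * (K ^ (1 / α - 1) / Real.log 2) + 2 / Real.log 2 ^ (1 / α) with hC
  have hlog2 : 0 < Real.log 2 := Real.log_pos (by norm_num)
  refine ⟨C, fun n hn => ?_⟩
  have hn1 : (1 : ℝ) < n := by exact_mod_cast hn
  have hn2 : (2 : ℝ) ≤ n := by exact_mod_cast hn
  have hn0 : (0 : ℝ) < n := by linarith
  have hlog : 0 < Real.log n := Real.log_pos hn1
  have hlogle : Real.log 2 ≤ Real.log n := Real.log_le_log (by norm_num) hn2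
  have hr0 : 0 < rate α n := by unfold rate; positivity
  set e := K * (Real.log n / n) with he
  have he0 : 0 < e := by positivity
  rcases le_total e 1 with h1 | h1
  · right
    set ε := e ^ (1 / α) with hε
    have hεα : ε ^ α = e := by
      rw [hε, ← Real.rpow_mul he0.le, one_div_mul_cancel hα.ne', Real.rpow_one]
    have hε1α : ε ^ (1 - α) = K ^ (1 / α - 1) * (rate α n / Real.log n) := by
      rw [hε, ← Real.rpow_mul he0.le, show 1 / α * (1 - α) = 1 / α - 1 by field_simp, he,
        Real.mul_rpow hK0.le (by positivity), Real.div_rpow hlog.le hn0.le, rate,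
        show 1 - 1 / α = -(1 / α - 1) by ring, Real.rpow_neg hn0.le,
        Real.rpow_sub hlog, Real.rpow_one]
      field_simp
    refine ⟨ε, by positivity, Real.rpow_le_one he0.le h1 (by positivity), ?_⟩
    rw [hεα, hε1α]
    have h2 : (1 - θ * e) ^ n ≤ rate α n / Real.log n ^ (1 / α) := by
      calc (1 - θ * e) ^ n ≤ Real.exp (-(θ * e)) ^ n :=
            pow_le_pow_left₀ (by nlinarith) (Real.one_sub_le_exp_neg _) n
        _ = (n : ℝ) ^ (1 - 1 / α) := by
            rw [← Real.exp_nat_mul, Real.rpow_def_of_pos hn0]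
            congr 1
            rw [he, hK]
            field_simp
            ring
        _ = _ := by
            rw [rate]
            field_simp
    have h3 : rate α n / Real.log n ≤ rate α n / Real.log 2 := by gcongr
    have h4 : rate α n / Real.log n ^ (1 / α) ≤ rate α n / Real.log 2 ^ (1 / α) := by gcongr
    have h5 : 0 ≤ K ^ (1 / α) * rate α n := by positivity
    have h6 : D * (K ^ (1 / α - 1) * (rate α n / Real.log n)) ≤
      D * (K ^ (1 / α - 1) * (rate α n / Real.log 2)) := by gcongr
    have h7 : C * rate α n = 2 * (K ^ (1 / α) * rate α n) +
        D * (K ^ (1 / α - 1) * (rate α n / Real.log 2)) +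
        2 * (rate α n / Real.log 2 ^ (1 / α)) := by rw [hC]; ring
    linarith
  · left
    have h2 : K ^ (1 / α) * rate α n = n * e ^ (1 / α) := by
      rw [he, Real.mul_rpow hK0.le (by positivity), Real.div_rpow hlog.le hn0.le, rate,
        Real.rpow_sub hn0, Real.rpow_one]
      ring
    have h3 : 1 ≤ e ^ (1 / α) := Real.one_le_rpow h1 (by positivity)
    have h4 : 1 ≤ K ^ (1 / α) * rate α n := by rw [h2]; nlinarith
    have h5 : 2 * K ^ (1 / α) ≤ C := by
      have : 0 ≤ D * (K ^ (1 / α - 1) / Real.log 2) + 2 / Real.log 2 ^ (1 / α) := by positivity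
      linarith
    nlinarith [mul_le_mul_of_nonneg_right h5 hr0.le]

lemma loss_of_memory_cone {α : ℝ} (hα : 0 < α) (hα1 : α < 1) (a : ℝ) :
    ∃ C : ℝ, ∀ n : ℕ, 1 < n →
      ∀ β : ℕ → ℝ, (∀ k : ℕ, 1 ≤ k → k ≤ n → 0 < β k ∧ β k ≤ α) →
      ∀ φ ψ : ℝ → ℝ, φ ∈ coneTwo α a → ψ ∈ coneTwo α a →
        ∫ x in Ioc (0 : ℝ) 1, φ x = ∫ x in Ioc (0 : ℝ) 1, ψ x →
        ∫ x in Ioc (0 : ℝ) 1, |transferSeq β n φ x - transferSeq β n ψ x| ≤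
          C * (normL1 φ + normL1 ψ) * rate α n := by
  set A := max (a + 1) (9 / (1 - α)) with hA
  have hA9 : 9 / (1 - α) ≤ A := le_max_right _ _
  have hA1 : 1 ≤ A := by
    have : 9 ≤ A * (1 - α) := (div_le_iff₀ (by linarith)).1 hA9
    nlinarith
  obtain ⟨κ, hκ, hlow⟩ := exists_le_apply_one hα hα1 hA1
  set θ := min (κ / 12) ((1 - α) / 6) with hθ
  have hθ0 : 0 < θ := lt_min (by positivity) (by linarith)
  have hθα : θ ≤ (1 - α) / 6 := min_le_right _ _
  have hθκ : θ ≤ κ / 12 := min_le_left _ _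
  obtain ⟨C, hC⟩ := exists_rate_bound (D := 4 * A / (1 - α) + 4 * (2 + A) / θ) hα hα1 hθ0
    (by linarith) (add_nonneg (div_nonneg (by linarith) (by linarith)) (by positivity))
  refine ⟨C / 2, fun n hn β hβ φ ψ hφ hψ hφψ => ?_⟩
  have norm_eq : ∀ f ∈ coneTwo α a, normL1 f = ∫ x in Ioc (0 : ℝ) 1, f x := fun f hf =>
    setIntegral_congr_fun measurableSet_Ioc fun x hx => abs_of_nonneg (hf.1.2.1 x hx)
  set m := ∫ x in Ioc (0 : ℝ) 1, φ x with hm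
  have hm0 : 0 ≤ m := setIntegral_nonneg measurableSet_Ioc hφ.1.2.1
  have hnφ := norm_eq φ hφ
  have hnψ := norm_eq ψ hψ
  rw [← hm] at hnφ
  rw [← hφψ] at hnψ
  have hgoal : C / 2 * (normL1 φ + normL1 ψ) * rate α n = m * (C * rate α n) := by
    rw [hnφ, hnψ]; ring
  rw [hgoal]
  have hpos : ∀ k : ℕ, 1 ≤ k → k ≤ n → 0 < β k := fun k h1 h2 => (hβ k h1 h2).1
  rcases hC n hn with h | ⟨ε, hε, hε1, h⟩
  · have h1 := integral_abs_sub_le (integrableOn_transferSeq hpos hφ.2.1)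
      (integrableOn_transferSeq hpos hψ.2.1)
    have h2 : ∫ x in Ioc (0 : ℝ) 1, |transferSeq β n φ x| ≤ m :=
      (integral_abs_transferSeq_le hpos hφ.2.1).trans hnφ.le
    have h3 : ∫ x in Ioc (0 : ℝ) 1, |transferSeq β n ψ x| ≤ m :=
      (integral_abs_transferSeq_le hpos hψ.2.1).trans hnψ.le
    nlinarith
  · refine (loss_of_memory_bound hα hα1 hβ hA9 (le_max_left _ _) hθ0 hθα hε hε1 ?_ hφ hψ hm.symm
      hφψ.symm).trans (mul_le_mul_of_nonneg_left h hm0)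
    intro m' h hh
    have hm' : 0 ≤ m' := hh.integral_eq ▸ setIntegral_nonneg measurableSet_Ioc hh.nonneg
    have := hlow ε m' h hh
    nlinarith [mul_le_mul_of_nonneg_right hθκ hm']

/-! ### Functions of class `C¹` -/

lemma abs_le_iSup_of_periodic {f : ℝ → ℝ} (hf : Continuous f) (hp : Function.Periodic f 1) (x : ℝ) :
    |f x| ≤ ⨆ y : ℝ, |f y| := by
  refine le_ciSup (f := fun y => |f y|) ?_ x
  obtain ⟨B, hB⟩ := (isBounded_iff_forall_norm_le.1
    (hp.isBounded_of_continuous one_ne_zero hf))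
  exact ⟨B, by rintro _ ⟨y, rfl⟩; exact hB _ (mem_range_self y)⟩

lemma abs_add_abs_deriv_le {f : ℝ → ℝ} (hf : IsC1Circle f) (x y : ℝ) :
    |f x| + |deriv f y| ≤ normC1 f := by
  refine add_le_add (abs_le_iSup_of_periodic hf.1.continuous hf.2 x)
    (abs_le_iSup_of_periodic (hf.1.continuous_deriv le_rfl) (fun z => ?_) y)
  have h : (fun w => f (w + 1)) = f := funext hf.2
  rw [← deriv_comp_add_const, h]

/-- Subtracting the function `N * x - 5 * N`, which is the same for all functions of norm at most
`N`, moves a `C¹` function into the cone; periodicity only serves to make the suprema finite. -/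
lemma mem_coneTwo_of_C1 {α N : ℝ} {φ : ℝ → ℝ} (hα : 0 < α) (hφ : IsC1Circle φ)
    (hN : normC1 φ ≤ N) :
    (fun x => φ x - (N * x - 5 * N)) ∈ coneTwo α 2 ∧
      normL1 (fun x => φ x - (N * x - 5 * N)) ≤ 6 * N := by
  set f : ℝ → ℝ := fun x => φ x - (N * x - 5 * N) with hf
  have hb : ∀ x, |φ x| ≤ N := fun x => by
    have := abs_add_abs_deriv_le hφ x x
    linarith [abs_nonneg (deriv φ x)]
  have hb' : ∀ x, |deriv φ x| ≤ N := fun x => by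
    have := abs_add_abs_deriv_le hφ x x
    linarith [abs_nonneg (φ x)]
  have hN0 : 0 ≤ N := (abs_nonneg _).trans (hb 0)
  have hd : ∀ x, HasDerivAt f (deriv φ x - N) x := by
    intro x
    have h1 := (hφ.1.differentiable one_ne_zero x).hasDerivAt
    have h2 : HasDerivAt (fun x : ℝ => N * x - 5 * N) N x := by
      simpa using ((hasDerivAt_id x).const_mul N).sub_const (5 * N)
    exact h1.sub h2
  have hcont : Continuous f := continuous_iff_continuousAt.2 fun x => (hd x).continuousAt
  have hlow : ∀ x ∈ Ioc (0 : ℝ) 1, 3 * N ≤ f x := fun x hx => by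
    have := (abs_le.1 (hb x)).1
    simp only [hf]
    nlinarith [hx.2]
  have hup : ∀ x ∈ Ioc (0 : ℝ) 1, f x ≤ 6 * N := fun x hx => by
    have := (abs_le.1 (hb x)).2
    simp only [hf]
    nlinarith [hx.1]
  have hi : IntegrableOn f (Ioc 0 1) :=
    (hcont.integrableOn_Icc (a := 0) (b := 1)).mono_set Ioc_subset_Icc_self
  have hci : ∀ c : ℝ, IntegrableOn (fun _ : ℝ => c) (Ioc 0 1) :=
    fun c => integrableOn_const (by simp)
  have hint : 3 * N ≤ ∫ x in Ioc (0 : ℝ) 1, f x := by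
    have h := setIntegral_mono_on (hci (3 * N)) hi measurableSet_Ioc hlow
    rw [setIntegral_const, Real.volume_real_Ioc_of_le zero_le_one] at h
    simpa using h
  have hnorm : normL1 f ≤ 6 * N := by
    have h := setIntegral_mono_on hi.abs (hci (6 * N)) measurableSet_Ioc fun x hx => by
      rw [abs_of_nonneg (le_trans (by positivity) (hlow x hx))]
      exact hup x hx
    rw [setIntegral_const, Real.volume_real_Ioc_of_le zero_le_one] at h
    simpa [normL1] using h
  refine ⟨⟨⟨hcont.continuousOn, fun x hx => le_trans (by positivity) (hlow x hx), ?_, ?_⟩, hi, ?_⟩,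
    hnorm⟩
  · refine (antitone_of_deriv_nonpos (fun x => (hd x).differentiableAt) fun x => ?_).antitoneOn _
    rw [(hd x).deriv]
    linarith [(abs_le.1 (hb' x)).2]
  · have hd' : ∀ x ∈ Ioc (0 : ℝ) 1, HasDerivAt (fun x => x ^ (α + 1) * f x)
        ((α + 1) * x ^ α * f x + x ^ (α + 1) * (deriv φ x - N)) x := by
      intro x hx
      have := (Real.hasDerivAt_rpow_const (p := α + 1) (Or.inl hx.1.ne')).mul (hd x)
      rwa [add_sub_cancel_right] at this
    refine monotoneOn_of_deriv_nonneg (convex_Ioc 0 1)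
      (fun x hx => (hd' x hx).continuousAt.continuousWithinAt)
      (fun x hx => (hd' x (interior_subset hx)).differentiableAt.differentiableWithinAt) ?_
    intro x hx
    have hx := interior_subset hx
    have hx0 := hx.1
    rw [(hd' x hx).deriv, Real.rpow_add hx0, Real.rpow_one]
    have h1 : 0 ≤ (α + 1) * f x + x * (deriv φ x - N) := by
      have := hlow x hx
      have := (abs_le.1 (hb' x)).1
      nlinarith [hx.2, mul_nonneg hα.le (le_trans (by positivity) (hlow x hx) : (0 : ℝ) ≤ f x)]
    have h2 : 0 ≤ x ^ α := by positivity
    nlinarith [mul_nonneg h2 h1]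
  · intro x hx
    have h1 : 1 ≤ x ^ (-α) := Real.one_le_rpow_of_pos_of_le_one_of_nonpos hx.1 hx.2 (by linarith)
    have := hup x hx
    nlinarith

end PomeauManneville

end

/-! ### Loss of memory -/

theorem theorem2p6 :
    ∃ F : ℝ →ᵃ[ℝ] ℝ, ∀ α : ℝ, 0 < α → α < 1 →
      (∀ a : ℝ, ∃ C : ℝ, ∀ n : ℕ, 1 < n →
        ∀ β : ℕ → ℝ, (∀ k : ℕ, 1 ≤ k → k ≤ n → 0 < β k ∧ β k ≤ α) →
        ∀ φ ψ : ℝ → ℝ,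
          φ ∈ PomeauManneville.coneTwo α a → ψ ∈ PomeauManneville.coneTwo α a →
          ∫ x in Set.Ioc (0 : ℝ) 1, φ x = ∫ x in Set.Ioc (0 : ℝ) 1, ψ x →
          MeasureTheory.IntegrableOn (PomeauManneville.transferSeq β n φ) (Set.Ioc 0 1) ∧
          MeasureTheory.IntegrableOn (PomeauManneville.transferSeq β n ψ) (Set.Ioc 0 1) ∧
          ∫ x in Set.Ioc (0 : ℝ) 1,
              |PomeauManneville.transferSeq β n φ x - PomeauManneville.transferSeq β n ψ x| ≤
            C * (PomeauManneville.normL1 φ + PomeauManneville.normL1 ψ) *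
              PomeauManneville.rate α n) ∧
      (∃ C : ℝ, ∀ n : ℕ, 1 < n →
        ∀ β : ℕ → ℝ, (∀ k : ℕ, 1 ≤ k → k ≤ n → 0 < β k ∧ β k ≤ α) →
        ∀ φ ψ : ℝ → ℝ,
          PomeauManneville.IsC1Circle φ → PomeauManneville.IsC1Circle ψ →
          ∫ x in Set.Ioc (0 : ℝ) 1, φ x = ∫ x in Set.Ioc (0 : ℝ) 1, ψ x →
          MeasureTheory.IntegrableOn (PomeauManneville.transferSeq β n φ) (Set.Ioc 0 1) ∧
          MeasureTheory.IntegrableOn (PomeauManneville.transferSeq β n ψ) (Set.Ioc 0 1) ∧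
          ∫ x in Set.Ioc (0 : ℝ) 1,
              |PomeauManneville.transferSeq β n φ x - PomeauManneville.transferSeq β n ψ x| ≤
            C * F (PomeauManneville.normC1 φ + PomeauManneville.normC1 ψ) *
              PomeauManneville.rate α n) := by
  refine ⟨AffineMap.id ℝ ℝ, fun α hα hα1 => ⟨fun a => ?_, ?_⟩⟩
  · obtain ⟨C, hC⟩ := PomeauManneville.loss_of_memory_cone hα hα1 a
    refine ⟨C, fun n hn β hβ φ ψ hφ hψ hφψ => ?_⟩
    have hpos : ∀ k : ℕ, 1 ≤ k → k ≤ n → 0 < β k := fun k h1 h2 => (hβ k h1 h2).1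
    exact ⟨PomeauManneville.integrableOn_transferSeq hpos hφ.2.1,
      PomeauManneville.integrableOn_transferSeq hpos hψ.2.1, hC n hn β hβ φ ψ hφ hψ hφψ⟩
  · obtain ⟨C, hC⟩ := PomeauManneville.loss_of_memory_cone hα hα1 2
    refine ⟨12 * |C|, fun n hn β hβ φ ψ hφ hψ hφψ => ?_⟩
    have hpos : ∀ k : ℕ, 1 ≤ k → k ≤ n → 0 < β k := fun k h1 h2 => (hβ k h1 h2).1
    have hint : ∀ f : ℝ → ℝ, Continuous f → IntegrableOn f (Ioc 0 1) := fun f hf =>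
      (hf.integrableOn_Icc (a := 0) (b := 1)).mono_set Ioc_subset_Icc_self
    have hφi := hint φ hφ.1.continuous
    have hψi := hint ψ hψ.1.continuous
    refine ⟨PomeauManneville.integrableOn_transferSeq hpos hφi,
      PomeauManneville.integrableOn_transferSeq hpos hψi, ?_⟩
    set N := PomeauManneville.normC1 φ + PomeauManneville.normC1 ψ with hN
    have hφ0 : 0 ≤ PomeauManneville.normC1 φ :=
      le_trans (by positivity) (PomeauManneville.abs_add_abs_deriv_le hφ 0 0)
    have hψ0 : 0 ≤ PomeauManneville.normC1 ψ :=
      le_trans (by positivity) (PomeauManneville.abs_add_abs_deriv_le hψ 0 0)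
    have hai : IntegrableOn (fun x : ℝ => N * x - 5 * N) (Ioc 0 1) := hint _ (by fun_prop)
    obtain ⟨hφc, hφn⟩ :=
      PomeauManneville.mem_coneTwo_of_C1 hα hφ (show PomeauManneville.normC1 φ ≤ N by linarith)
    obtain ⟨hψc, hψn⟩ :=
      PomeauManneville.mem_coneTwo_of_C1 hα hψ (show PomeauManneville.normC1 ψ ≤ N by linarith)
    have h := hC n hn β hβ _ _ hφc hψc (by rw [integral_sub hφi hai, integral_sub hψi hai, hφψ])
    simp only [PomeauManneville.transferSeq_sub hpos, sub_sub_sub_cancel_right] at h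
    refine h.trans ?_
    have hr : 0 ≤ PomeauManneville.rate α n := by
      unfold PomeauManneville.rate
      have := Real.log_nonneg (show (1 : ℝ) ≤ n by exact_mod_cast hn.le)
      positivity
    refine mul_le_mul_of_nonneg_right ?_ hr
    have hnn : ∀ f, 0 ≤ PomeauManneville.normL1 f := fun f =>
      integral_nonneg fun x => abs_nonneg _
    refine (mul_le_mul_of_nonneg_right (le_abs_self C) (add_nonneg (hnn _) (hnn _))).trans ?_
    refine (mul_le_mul_of_nonneg_left (add_le_add hφn hψn) (abs_nonneg C)).trans (le_of_eq ?_)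
    simp only [AffineMap.id_apply]
    ring
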